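/- Let $G$ be a group with a left-invariant lattice order $\preceq$ (with meet $\wedge$), let $P=\{x\in G: 1\preceq x\}$ be its positive cone, and let $\Delta\in P$ define a Garside structure of finite type: the set of simple elements $[1,\Delta]=\{s: 1\preceq s\preceq\Delta\}$ is finite and generates $G$, $\Delta^{-1}P\Delta=P$, and for every $x\in P$ the lengths of the strict chains from $1$ to $x$ are bounded. Write $\tau(x)=\Delta^{-1}x\Delta$. The left normal form of $X\in G$ is the decomposition $X=\Delta^p x_1\cdots x_r$ with $p\in\mathbb Z$ maximal such that $\Delta^p\preceq X$, all $x_i\neq 1$, and $x_i=(x_i\cdots x_r)\wedge\Delta$ for $i=1,\dots,r$; put $\ell(X)=r$. The initial factor is $\iota(X)=\tau^{-p}(x_1)$ (and $\iota(X)=1$ if $r=0$), and the cycling of $X$ is $\mathbf c(X)=\iota(X)^{-1}X\,\iota(X)$. The super summit set $SSS(X)$ is the set of conjugates of $X$ of minimal $\ell$, and the ultra summit set $USS(X)$ is the set of $Y\in SSS(X)$ with $\mathbf c^n(Y)=Y$ for some $n>0$. The rigidity of $X$ is $\mathcal R(X)=k/r$ if $r>0$, where $k$ is the biggest integer in $\{0,\dots,r\}$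 such that the first $k$ factors (factors $\Delta$ included) of the left normal form of $x_1\cdots x_r\,\tau^{-p}(x_1)$ are precisely $x_1,\dots,x_k$; and $\mathcal R(X)=0$ if $r=0$. Let $X\in G$ with $\ell(X)\ge 1$. Then: 1. If $X\in USS(X)$, then $\mathcal R(X)\le\mathcal R(X^m)$ for every $m>1$. 2. If $X\in SSS(X)$, then $\mathcal R(X)\le\mathcal R(\mathbf c^t(X))$ for every $t\ge 1$. 3. If $X\in USS(X)$, then $\mathcal R(X)=\mathcal R(\mathbf c^t(X))$ for every $t\ge 1$. -/

import Mathlib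

/-!
A group `G` with a lattice order invariant under left multiplication is given by
`[Group G] [Lattice G] [MulLeftMono G]`.  The order `≤` is the prefix order, `⊓` is the (left) gcd,
and the positive cone is `Set.Ici (1 : G)`.
-/

namespace Garside

variable {G : Type*} [Group G] [Lattice G]

/-- `Δ` is the Garside element of a Garside structure of finite type on the group `G`, whose lattice
order (invariant under left multiplication, see `MulLeftMono`) is the prefix order. -/
structure IsGarsideElement (Δ : G) : Prop where
  /-- `Δ` is positive -/
  one_le : 1 ≤ Δ
  /-- the simple elements generate `G` -/
  closure_simple : Subgroup.closure (Set.Icc 1 Δ) = ⊤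
  /-- there are finitely many simple elements -/
  finite_simple : (Set.Icc 1 Δ).Finite
  /-- `Δ⁻¹ P Δ = P` -/
  conj_positive : (fun x => Δ⁻¹ * x * Δ) '' Set.Ici (1 : G) = Set.Ici 1
  /-- the positive cone is atomic: strict chains from `1` to a given positive `x` have bounded
  length -/
  atomic : ∀ x : G, 1 ≤ x → ∃ N : ℕ, ∀ s : LTSeries G, s.head = 1 → s.last = x → s.length ≤ N

/-- The list `x₁, …, x_r` consists of nontrivial elements such that `xᵢ = (xᵢ ⋯ x_r) ∧ Δ` for
every `i`. -/
def IsGreedy (Δ : G) : List G → Prop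
  | [] => True
  | x :: xs => x ≠ 1 ∧ x = (x :: xs).prod ⊓ Δ ∧ IsGreedy Δ xs

/-- `X = Δ ^ p * x₁ * ⋯ * x_r` is the left normal form of `X`. -/
structure IsLeftNormalForm (Δ X : G) (p : ℤ) (xs : List G) : Prop where
  eq_prod : X = Δ ^ p * xs.prod
  isGreatest : IsGreatest {q : ℤ | Δ ^ q ≤ X} p
  greedy : IsGreedy Δ xs

theorem IsGreedy.unique {Δ : G} : ∀ {xs ys : List G}, IsGreedy Δ xs → IsGreedy Δ ys → 1 ≤ Δ →
    xs.prod = ys.prod → xs = ys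
  | [], [], _, _, _, _ => rfl
  | [], y :: ys, _, hy, hΔ, h => by
      obtain ⟨h1, h2, _⟩ := hy
      rw [← h, List.prod_nil, inf_eq_left.2 hΔ] at h2
      exact absurd h2 h1
  | x :: xs, [], hx, _, hΔ, h => by
      obtain ⟨h1, h2, _⟩ := hx
      rw [h, List.prod_nil, inf_eq_left.2 hΔ] at h2
      exact absurd h2 h1
  | x :: xs, y :: ys, hx, hy, hΔ, h => by
      obtain ⟨_, hx2, hx3⟩ := hx
      obtain ⟨_, hy2, hy3⟩ := hy
      have hxy : x = y := by rw [hx2, hy2, h]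
      subst hxy
      rw [List.prod_cons, List.prod_cons] at h
      rw [IsGreedy.unique hx3 hy3 hΔ (mul_left_cancel h)]

theorem IsLeftNormalForm.unique {Δ X : G} (hΔ : 1 ≤ Δ) {p q : ℤ} {xs ys : List G}
    (h : IsLeftNormalForm Δ X p xs) (h' : IsLeftNormalForm Δ X q ys) : p = q ∧ xs = ys := by
  have hpq : p = q := h.isGreatest.unique h'.isGreatest
  subst hpq
  refine ⟨rfl, h.greedy.unique h'.greedy hΔ ?_⟩
  exact mul_left_cancel (h.eq_prod.symm.trans h'.eq_prod)

section existence

variable [MulLeftMono G] {Δ : G}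

theorem IsGarsideElement.mul_right_mono (hΔ : IsGarsideElement Δ) {a b : G} (h : a ≤ b) :
    a * Δ ≤ b * Δ := by
  have h1 : (1 : G) ≤ a⁻¹ * b := by simpa using mul_le_mul_right h a⁻¹
  have h2 : (1 : G) ≤ Δ⁻¹ * (a⁻¹ * b) * Δ := by
    have : Δ⁻¹ * (a⁻¹ * b) * Δ ∈ (fun x => Δ⁻¹ * x * Δ) '' Set.Ici (1 : G) := ⟨_, h1, rfl⟩
    rw [hΔ.conj_positive] at this
    exact this
  simpa [mul_assoc] using mul_le_mul_right h2 (a * Δ)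

theorem IsGarsideElement.mul_right_mono_pow (hΔ : IsGarsideElement Δ) {a b : G} (h : a ≤ b)
    (n : ℕ) : a * Δ ^ n ≤ b * Δ ^ n := by
  induction n with
  | zero => simpa using h
  | succ n ih => simpa [pow_succ, mul_assoc] using hΔ.mul_right_mono ih

theorem IsGarsideElement.exists_le_pow (hΔ : IsGarsideElement Δ) (X : G) :
    ∃ n : ℕ, X ≤ Δ ^ n ∧ X⁻¹ ≤ Δ ^ n := by
  have hX : X ∈ Subgroup.closure (Set.Icc 1 Δ) := by rw [hΔ.closure_simple]; trivial
  induction hX using Subgroup.closure_induction with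
  | mem x hx =>
      refine ⟨1, by simpa using hx.2, ?_⟩
      have : x⁻¹ ≤ 1 := by simpa using mul_le_mul_right hx.1 x⁻¹
      simpa using this.trans hΔ.one_le
  | one => exact ⟨0, by simp, by simp⟩
  | mul x y _ _ hx hy =>
      obtain ⟨a, ha, ha'⟩ := hx
      obtain ⟨b, hb, hb'⟩ := hy
      refine ⟨a + b, ?_, ?_⟩
      · calc x * y ≤ x * Δ ^ b := mul_le_mul_right hb x
          _ ≤ Δ ^ a * Δ ^ b := hΔ.mul_right_mono_pow ha b
          _ = Δ ^ (a + b) := (pow_add _ _ _).symm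
      · calc (x * y)⁻¹ = y⁻¹ * x⁻¹ := mul_inv_rev _ _
          _ ≤ y⁻¹ * Δ ^ a := mul_le_mul_right ha' _
          _ ≤ Δ ^ b * Δ ^ a := hΔ.mul_right_mono_pow hb' a
          _ = Δ ^ (a + b) := by rw [← pow_add, add_comm]
  | inv x _ hx =>
      obtain ⟨a, ha, ha'⟩ := hx
      exact ⟨a, ha', by simpa using ha⟩

theorem IsGarsideElement.inf_ne_one (hΔ : IsGarsideElement Δ) {Y : G} (hY : Y ≠ 1) :
    Y ⊓ Δ ≠ 1 := by
  intro h
  have hY1 : 1 ≤ Y := h ▸ inf_le_left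
  have key : ∀ n : ℕ, Y ⊓ Δ ^ n ≤ 1 := by
    intro n
    induction n with
    | zero => simp
    | succ k ih =>
      have h0 : Y ⊓ Δ ^ (k + 1) ≤ Δ ^ k := by
        have hk : (1 : G) ≤ Δ ^ k := one_le_pow_of_one_le' hΔ.one_le k
        set Z := Y ⊓ Δ ^ (k + 1) with hZ
        have a1 : Z ≤ Y * Δ ^ k :=
          inf_le_left.trans (by simpa using mul_le_mul_right hk Y)
        have a2 : Z ≤ Δ ^ (k + 1) := inf_le_right
        have inv_mono : ∀ {a b : G}, a ≤ b * Δ ^ k → a * (Δ ^ k)⁻¹ ≤ b := by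
          intro a b hab
          obtain ⟨x, hx, hxe⟩ : (a⁻¹ * (b * Δ ^ k)) ∈
              (fun x => (Δ ^ k)⁻¹ * x * Δ ^ k) '' Set.Ici (1 : G) := by
            have : ∀ n : ℕ, (fun x => (Δ ^ n)⁻¹ * x * Δ ^ n) '' Set.Ici (1 : G) = Set.Ici 1 := by
              intro n
              induction n with
              | zero => simp
              | succ n ihn =>
                conv_rhs => rw [← hΔ.conj_positive, ← ihn, Set.image_image]
                refine Set.image_congr fun x _ => ?_
                simp [pow_succ, mul_assoc]
            rw [this]
            simpa using mul_le_mul_right hab a⁻¹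
          have : x = Δ ^ k * a⁻¹ * b := by
            have := congrArg (fun z => Δ ^ k * z * (Δ ^ k)⁻¹) hxe
            simpa [mul_assoc] using this
          have hx' : 1 ≤ Δ ^ k * a⁻¹ * b := this ▸ hx
          simpa [mul_assoc] using mul_le_mul_right hx' (a * (Δ ^ k)⁻¹)
        have b1 := inv_mono a1
        have b2 : Z * (Δ ^ k)⁻¹ ≤ Δ := inv_mono (by rwa [pow_succ'] at a2)
        have b3 : Z * (Δ ^ k)⁻¹ ≤ 1 := h ▸ le_inf b1 b2
        simpa using hΔ.mul_right_mono_pow b3 k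
      exact (le_inf inf_le_left h0).trans ih
  obtain ⟨n, hn, _⟩ := hΔ.exists_le_pow Y
  exact hY (le_antisymm ((le_inf le_rfl hn).trans (key n)) hY1)

theorem IsGarsideElement.exists_greedy (hΔ : IsGarsideElement Δ) {Y : G} (hY : 1 ≤ Y) :
    ∃ xs : List G, IsGreedy Δ xs ∧ xs.prod = Y := by
  obtain ⟨N, hN⟩ := hΔ.atomic Y hY
  induction N generalizing Y with
  | zero =>
      by_cases h : Y = 1
      · exact ⟨[], trivial, by simp [h]⟩
      · have hlt : 1 < Y := lt_of_le_of_ne hY (Ne.symm h)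
        have := hN (RelSeries.cons (RelSeries.singleton _ Y) 1 hlt) rfl rfl
        exact absurd this (by simp [RelSeries.cons, RelSeries.append])
  | succ N ih =>
      by_cases h : Y = 1
      · exact ⟨[], trivial, by simp [h]⟩
      · set y := Y ⊓ Δ with hy
        have hy1 : y ≠ 1 := hΔ.inf_ne_one h
        have hy0 : 1 ≤ y := le_inf hY hΔ.one_le
        have hlt : 1 < y := lt_of_le_of_ne hy0 (Ne.symm hy1)
        have h1 : 1 ≤ y⁻¹ * Y := by
          have := mul_le_mul_right (inf_le_left : y ≤ Y) y⁻¹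
          rwa [inv_mul_cancel] at this
        obtain ⟨xs, hxs, hprod⟩ := ih h1 (by
          intro s hs hs'
          have hsm : StrictMono (fun x : G => y * x) := by
            intro a b hab
            exact lt_of_le_of_ne (mul_le_mul_right hab.le y) (fun e => hab.ne (mul_left_cancel e))
          have hhead : (s.map _ hsm).head = y := by simp [hs]
          have := hN ((s.map _ hsm).cons 1 (by rw [hhead]; exact hlt)) (by simp)
            (by simp [hs'])
          simpa using this)
        refine ⟨y :: xs, ⟨hy1, ?_, hxs⟩, by simp [hprod]⟩
        simp [hprod, hy]

/-- Left normal forms exist.  (If `Δ = 1`, then `G` is trivial.) -/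
theorem IsGarsideElement.exists_leftNormalForm (hΔ : IsGarsideElement Δ) (hne : Δ ≠ 1) (X : G) :
    ∃ p xs, IsLeftNormalForm Δ X p xs := by
  have h1 : 1 < Δ := lt_of_le_of_ne hΔ.one_le (Ne.symm hne)
  obtain ⟨n, hn, hn'⟩ := hΔ.exists_le_pow X
  have hneg : ∀ k : ℕ, 1 ≤ Δ ^ k := fun k => one_le_pow_of_one_le' hΔ.one_le k
  have hbdd : ∀ q : ℤ, Δ ^ q ≤ X → q ≤ n := by
    intro q hq
    by_contra hlt
    push Not at hlt
    obtain ⟨k, hk⟩ := Int.eq_ofNat_of_zero_le (by omega : 0 ≤ q - n - 1)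
    have e : q = (n : ℤ) + ((k + 1 : ℕ) : ℤ) := by push_cast; omega
    have h2 : Δ ^ n * Δ ^ (k + 1) ≤ Δ ^ n * 1 := by
      have := hq.trans hn
      rw [e, zpow_add, zpow_natCast, zpow_natCast] at this
      simpa using this
    have h3 : Δ ^ (k + 1) ≤ 1 := by simpa using mul_le_mul_right h2 (Δ ^ n)⁻¹
    have h4 : Δ ≤ Δ ^ (k + 1) := by
      rw [pow_succ']
      simpa using mul_le_mul_right (hneg k) Δ
    exact absurd (h4.trans h3) h1.not_ge
  have hmem : Δ ^ (-(n : ℤ)) ≤ X := by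
    have a : X * X⁻¹ ≤ X * Δ ^ n := mul_le_mul_right hn' X
    rw [mul_inv_cancel] at a
    have b : ∀ m : ℕ, ∀ {c : G}, 1 ≤ c * Δ ^ m → (Δ ^ m)⁻¹ ≤ c := by
      intro m c hc
      induction m generalizing c with
      | zero => simpa using hc
      | succ m ih =>
        have h5 : (Δ ^ m)⁻¹ ≤ c * Δ := ih (by rwa [mul_assoc, ← pow_succ'])
        have h6 : (1 : G) ≤ Δ ^ m * (c * Δ) := by
          simpa using mul_le_mul_right h5 (Δ ^ m)
        rw [← Set.mem_Ici, ← hΔ.conj_positive] at h6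
        obtain ⟨x, hx, hxe⟩ := h6
        have : x = Δ ^ (m + 1) * c := by
          have := congrArg (fun z => Δ * z * Δ⁻¹) hxe
          simpa [pow_succ', mul_assoc] using this
        have hx' : 1 ≤ Δ ^ (m + 1) * c := this ▸ hx
        simpa using mul_le_mul_right hx' (Δ ^ (m + 1))⁻¹
    simpa using b n a
  obtain ⟨p, hp, hpmax⟩ := Int.exists_greatest_of_bdd (P := fun q : ℤ => Δ ^ q ≤ X)
    ⟨n, hbdd⟩ ⟨_, hmem⟩
  have hpos : 1 ≤ (Δ ^ p)⁻¹ * X := by simpa using mul_le_mul_right hp (Δ ^ p)⁻¹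
  obtain ⟨xs, hxs, hprod⟩ := hΔ.exists_greedy hpos
  exact ⟨p, xs, by simp [hprod], ⟨hp, fun q hq => hpmax q hq⟩, hxs⟩

end existence

open Classical in
/-- The left normal form of `X`, as the pair of `p` and the list `x₁, …, x_r`. If there is none (only
when `G` is trivial), it is taken to be that of `Δ ^ 0`. -/
noncomputable def leftNormalForm (Δ X : G) : ℤ × List G :=
  if h : ∃ nf : ℤ × List G, IsLeftNormalForm Δ X nf.1 nf.2 then h.choose else (0, [])

/-- `inf(X) = p` -/
noncomputable def infimum (Δ X : G) : ℤ := (leftNormalForm Δ X).1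

/-- The non-`Δ` factors `x₁, …, x_r` of the left normal form of `X`. -/
noncomputable def factors (Δ X : G) : List G := (leftNormalForm Δ X).2

/-- `ℓ(X) = r` -/
noncomputable def canonicalLength (Δ X : G) : ℕ := (factors Δ X).length

/-- The shift map `τ(x) = Δ⁻¹ x Δ`. -/
def shift (Δ : G) : MulAut G := MulAut.conj Δ⁻¹

/-- The initial factor `ι(X) = τ⁻ᵖ(x₁)`, and `ι(X) = 1` if `r = 0`. -/
noncomputable def initialFactor (Δ X : G) : G :=
  (shift Δ ^ (-infimum Δ X)) ((factors Δ X).headD 1)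

/-- Cycling, `c(X) = ι(X)⁻¹ X ι(X)`. -/
noncomputable def cycling (Δ X : G) : G := (initialFactor Δ X)⁻¹ * X * initialFactor Δ X

/-- The super summit set: the conjugates of `X` of minimal canonical length. -/
def superSummitSet (Δ X : G) : Set G :=
  {Y | IsConj X Y ∧ ∀ Z, IsConj X Z → canonicalLength Δ Y ≤ canonicalLength Δ Z}

/-- The ultra summit set: the elements of the super summit set that are periodic under cycling. -/
def ultraSummitSet (Δ X : G) : Set G :=
  {Y | Y ∈ superSummitSet Δ X ∧ ∃ m : ℕ, 0 < m ∧ (cycling Δ)^[m] Y = Y}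

/-- All factors `Δ, …, Δ, y₁, …, y_t` of the left normal form of a positive element `Y`, each `Δ`
being counted as a factor. -/
noncomputable def allFactors (Δ Y : G) : List G :=
  List.replicate (infimum Δ Y).toNat Δ ++ factors Δ Y

open Classical in
/-- The largest `k ∈ {0, …, r}` such that the first `k` factors of the left normal form of
`x₁ ⋯ x_r τ⁻ᵖ(x₁)` are `x₁, …, x_k`, where `X = Δ ^ p x₁ ⋯ x_r` is in left normal form. -/
noncomputable def rigidityCount (Δ X : G) : ℕ :=
  Nat.findGreatest
    (fun k => (allFactors Δ ((factors Δ X).prod * initialFactor Δ X)).take k = (factors Δ X).take k)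
    (canonicalLength Δ X)

/-- The rigidity `R(X) = k / r`, and `R(X) = 0` if `r = 0`. -/
noncomputable def rigidity (Δ X : G) : ℚ :=
  if canonicalLength Δ X = 0 then 0 else (rigidityCount Δ X : ℚ) / (canonicalLength Δ X : ℚ)

end Garside

/-! Write `X = Δ ^ p x₁ ⋯ x_r`. The argument takes place in the lattice `G` with two commuting order
automorphisms, `A w = X w Δ ^ (-p)` and `D w = w Δ`, and their meet `C w = A w ⊓ D w`. Here `C 1 =
ι(X)`, and for `X` of minimal length `C^[t] 1` is the product of the first `t` initial factors met
under cycling. The first `k` factors of a positive element multiply to its meet with `Δ ^ k`, so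
rigidity at least `k / r` becomes the inequality `A (C 1) ⊓ D^[k] 1 ≤ A 1`.

Cycling: `C` preserves meets and commutes with `A` and `D`, so applying it to this inequality gives
the same one based at `ι(X)`, which is the inequality for the cycling of `X`. Rigidity thus grows
along cycling, and is constant on a periodic orbit.

Powers: if cycling has period `N` at `X`, then `g = C^[N] 1` commutes with `X`, and left
multiplication by `g` commutes with `A` and `D`. This forces `A^[m] 1 ⊓ D^[m] 1 = C^[m] 1`
(`iterate_inf_eq_meetMap_iterate`). If moreover `k ≥ 1`, the inequality propagates to `A^[a] 1 ⊓
D^[b] 1 ≤ C^[b] 1` (`iterate_inf_iterate_le`) and `C^[m * k] 1 ≤ A^[m] 1`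
(`meetMap_iterate_mul_le`). Hence `X ^ m` has infimum `m p`, the same initial factor as `X`, length
at most `m r`, and rigidity count at least the smaller of `m k` and its length. -/

namespace Garside

/-! ### Lattice inequalities for two commuting order automorphisms -/

section CommutingAutomorphisms

variable {L : Type*} [Lattice L]

/-- The meet `w ↦ A w ⊓ D w` of two order automorphisms. -/
def meetMap (A D : L ≃o L) (w : L) : L := A w ⊓ D w

variable {A D g : L ≃o L} {o : L}

theorem meetMap_mono (A D : L ≃o L) : Monotone (meetMap A D) := fun _ _ h =>
  inf_le_inf (A.monotone h) (D.monotone h)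

theorem meetMap_inf (A D : L ≃o L) (x y : L) :
    meetMap A D (x ⊓ y) = meetMap A D x ⊓ meetMap A D y := by
  simp only [meetMap, map_inf]
  exact inf_inf_inf_comm _ _ _ _

theorem meetMap_iterate_inf (A D : L ≃o L) (n : ℕ) (x y : L) :
    (meetMap A D)^[n] (x ⊓ y) = (meetMap A D)^[n] x ⊓ (meetMap A D)^[n] y := by
  induction n generalizing x y with
  | zero => rfl
  | succ n ih => simp only [Function.iterate_succ_apply, meetMap_inf, ih]

theorem meetMap_commute {B : L ≃o L} (hA : Function.Commute A B) (hD : Function.Commute D B) :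
    Function.Commute (meetMap A D) B := fun w => by
  simp only [meetMap, map_inf, hA w, hD w]

theorem meetMap_iterate_le {n i j : ℕ} (h : i + j = n) (w : L) :
    (meetMap A D)^[n] w ≤ A^[i] (D^[j] w) := by
  induction n generalizing i j with
  | zero =>
    obtain ⟨rfl, rfl⟩ : i = 0 ∧ j = 0 := by omega
    exact le_rfl
  | succ n ih =>
    rw [Function.iterate_succ_apply']
    rcases i with _ | i
    · obtain rfl : j = n + 1 := by omega
      rw [Function.iterate_zero_apply, Function.iterate_succ_apply']
      exact inf_le_right.trans (D.monotone (by simpa using ih (i := 0) (j := n) (by omega)))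
    · rw [Function.iterate_succ_apply']
      exact inf_le_left.trans (A.monotone (ih (by omega)))

/-- Peel the outermost `A` or `D` off and move it across the inequality by its inverse. With
`meetMap_iterate_le` this makes the `n`-th iterate the meet of all words with `n` letters in `A` and
`D`. -/
theorem le_meetMap_iterate (hAD : Function.Commute A D) {n : ℕ} {w z : L}
    (h : ∀ i j, i + j = n → z ≤ A^[i] (D^[j] w)) : z ≤ (meetMap A D)^[n] w := by
  induction n generalizing z with
  | zero => simpa using h 0 0 rfl
  | succ n ih =>
    rw [Function.iterate_succ_apply']
    refine le_inf ?_ ?_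
    · rw [← A.symm_apply_le]
      refine ih fun i j hij => ?_
      rw [A.symm_apply_le, ← Function.iterate_succ_apply' A]
      exact h (i + 1) j (by omega)
    · rw [← D.symm_apply_le]
      refine ih fun i j hij => ?_
      rw [D.symm_apply_le, ← (hAD.iterate_left i) (D^[j] w), ← Function.iterate_succ_apply' D]
      exact h i (j + 1) (by omega)

/-- After applying `N * m` further iterates of the meet map, the intermediate words missing from the
left side become available. By periodicity these iterates act as `g^[m]` on all elements involved,
so they can be cancelled. -/
theorem iterate_inf_eq_meetMap_iterate (hAD : Function.Commute A D) (hAg : Function.Commute A g)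
    (hDg : Function.Commute D g) {N : ℕ} (hN : 0 < N) (hg : (meetMap A D)^[N] o = g o) (m : ℕ) :
    A^[m] o ⊓ D^[m] o = (meetMap A D)^[m] o := by
  have hA : Function.Commute (meetMap A D) A := meetMap_commute (Function.Commute.refl _) hAD.symm
  have hD : Function.Commute (meetMap A D) D := meetMap_commute hAD (Function.Commute.refl _)
  have hG : Function.Commute (meetMap A D) g := meetMap_commute hAg hDg
  have per : ∀ n, (meetMap A D)^[N * n] o = g^[n] o := by
    intro n
    induction n with
    | zero => rfl
    | succ n ih =>
      rw [Nat.mul_succ, Nat.add_comm, Function.iterate_add_apply, ih,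
        (hG.iterate_left N).iterate_right n, hg, ← Function.iterate_succ_apply]
  have perA : (meetMap A D)^[N * m] (A^[m] o) = g^[m] (A^[m] o) := by
    rw [(hA.iterate_iterate _ _) o, per, (hAg.iterate_iterate _ _) o]
  have perD : (meetMap A D)^[N * m] (D^[m] o) = g^[m] (D^[m] o) := by
    rw [(hD.iterate_iterate _ _) o, per, (hDg.iterate_iterate _ _) o]
  have perC : (meetMap A D)^[N * m] ((meetMap A D)^[m] o) = g^[m] ((meetMap A D)^[m] o) := by
    rw [← Function.iterate_add_apply, Nat.add_comm, Function.iterate_add_apply, per,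
      (hG.iterate_iterate _ _) o]
  have hgm : StrictMono g^[m] := g.strictMono.iterate m
  refine le_antisymm ?_ (le_inf ?_ ?_)
  · have key : (meetMap A D)^[N * m] (A^[m] o ⊓ D^[m] o)
        ≤ (meetMap A D)^[N * m] ((meetMap A D)^[m] o) := by
      have hNm : m ≤ N * m := Nat.le_mul_of_pos_left m hN
      rw [← Function.iterate_add_apply, meetMap_iterate_inf]
      refine le_meetMap_iterate hAD fun i j hij => ?_
      -- A word with `N * m + m` letters has at least `m` letters `D`, or more than `N * m ≥ m`
      -- letters `A`; split off `D^[m]` or `A^[m]` accordingly.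
      by_cases hi : i ≤ N * m
      · refine inf_le_right.trans ((meetMap_iterate_le (i := i) (j := N * m - i)
          (by omega) _).trans_eq ?_)
        rw [← Function.iterate_add_apply]
        congr 2
        omega
      · refine inf_le_left.trans ((meetMap_iterate_le (i := i - m) (j := j)
          (by omega) _).trans_eq ?_)
        rw [← (hAD.iterate_iterate m j) o, ← Function.iterate_add_apply]
        congr 2
        omega
    rw [perC, meetMap_iterate_inf, perA, perD] at key
    have e : g^[m] (A^[m] o) ⊓ g^[m] (D^[m] o) = g^[m] (A^[m] o ⊓ D^[m] o) := by
      have : ∀ (n : ℕ) (x y : L), g^[n] x ⊓ g^[n] y = g^[n] (x ⊓ y) := by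
        intro n
        induction n with
        | zero => intro x y; rfl
        | succ n ih => intro x y; simp only [Function.iterate_succ_apply, ih, map_inf]
      exact this m _ _
    rw [e] at key
    have : ∀ (n : ℕ) (x y : L), g^[n] x ≤ g^[n] y → x ≤ y := by
      intro n
      induction n with
      | zero => exact fun _ _ h => h
      | succ n ih => exact fun x y h => g.le_iff_le.1 (ih _ _ h)
    exact this m _ _ key
  · simpa using meetMap_iterate_le (i := m) (j := 0) (by omega) o
  · simpa using meetMap_iterate_le (i := 0) (j := m) (by omega) o

theorem le_iterate_of_le (hA : o ≤ A o) {m n : ℕ} (h : m ≤ n) : A^[m] o ≤ A^[n] o :=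
  (A.monotone.monotone_iterate_of_le_map hA) h

theorem meetMap_iterate_le_succ (hA : o ≤ A o) (hD : o ≤ D o) (n : ℕ) :
    (meetMap A D)^[n] o ≤ (meetMap A D)^[n + 1] o :=
  (meetMap_mono A D).monotone_iterate_of_le_map (le_inf hA hD) n.le_succ

/-- The case `j = 0` is the rigidity inequality weakened from `k` to `1`; the others are its images
under the meet map. For cycling, it says that consecutive initial factors are left weighted. -/
theorem meetMap_iterate_weighted (hAD : Function.Commute A D) (hD : o ≤ D o) {k : ℕ} (hk : 1 ≤ k)
    (hrig : A (meetMap A D o) ⊓ D^[k] o ≤ A o) (j : ℕ) :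
    (meetMap A D)^[j + 2] o ⊓ D ((meetMap A D)^[j] o) ≤ (meetMap A D)^[j + 1] o := by
  have hDc : Function.Commute (meetMap A D) D := meetMap_commute hAD (Function.Commute.refl _)
  induction j with
  | zero =>
    refine le_inf ((le_inf (inf_le_left.trans inf_le_left) ?_).trans hrig) inf_le_right
    exact inf_le_right.trans (le_iterate_of_le hD hk)
  | succ j ih =>
    have := meetMap_mono A D ih
    rw [meetMap_inf, hDc] at this
    simpa only [← Function.iterate_succ_apply' (meetMap A D)] using this

theorem meetMap_iterate_inf_iterate_le (hAD : Function.Commute A D) (hD : o ≤ D o) {k : ℕ}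
    (hk : 1 ≤ k) (hrig : A (meetMap A D o) ⊓ D^[k] o ≤ A o) {n b : ℕ} (h : b ≤ n) :
    (meetMap A D)^[n] o ⊓ D^[b] o ≤ (meetMap A D)^[b] o := by
  have step : ∀ j, (meetMap A D)^[j + 1] o ⊓ D^[j] o ≤ (meetMap A D)^[j] o := by
    intro j
    induction j with
    | zero => exact inf_le_right
    | succ j ih =>
      refine (le_inf inf_le_left ?_).trans (meetMap_iterate_weighted hAD hD hk hrig j)
      -- The previous case shifted by `D` replaces `D^[j + 1] o` by the smaller `D (C^[j] o)` that
      -- the weighted inequality needs, `C` being the meet map.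
      refine le_trans ?_ (D.monotone ih)
      rw [map_inf, Function.iterate_succ_apply' (meetMap A D) (j + 1),
        Function.iterate_succ_apply' D]
      exact inf_le_inf inf_le_right le_rfl
  induction n, h using Nat.le_induction with
  | base => exact inf_le_left
  | succ n h ih =>
    refine (le_inf (le_trans ?_ (step n)) inf_le_right).trans ih
    exact inf_le_inf le_rfl (le_iterate_of_le hD h)

theorem map_meetMap_iterate_inf_iterate_le (hAD : Function.Commute A D) (hD : o ≤ D o) {k : ℕ}
    (hk : 1 ≤ k) (hrig : A (meetMap A D o) ⊓ D^[k] o ≤ A o) {n j : ℕ} (h : j ≤ n) :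
    A ((meetMap A D)^[n] o) ⊓ D^[k + j] o ≤ A ((meetMap A D)^[j] o) := by
  have step : ∀ j, A ((meetMap A D)^[j + 1] o) ⊓ D^[k + j] o ≤ A ((meetMap A D)^[j] o) := by
    intro j
    induction j with
    | zero => exact hrig
    | succ j ih =>
      refine le_trans (le_inf inf_le_left ?_)
        ((map_inf A _ _).ge.trans (A.monotone (meetMap_iterate_weighted hAD hD hk hrig j)))
      rw [hAD]
      refine le_trans ?_ (D.monotone ih)
      rw [map_inf, Function.iterate_succ_apply' (meetMap A D) (j + 1), ← Nat.add_assoc,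
        Function.iterate_succ_apply' D, ← hAD]
      exact inf_le_inf (A.monotone inf_le_right) le_rfl
  induction n, h using Nat.le_induction with
  | base => exact inf_le_left
  | succ n h ih =>
    refine (le_inf (le_trans ?_ (step n)) inf_le_right).trans ih
    exact inf_le_inf le_rfl (le_iterate_of_le hD (by omega))

/-- Each further block of `k` iterates costs one `A`: the iterate lies below both terms of the meet
in `map_meetMap_iterate_inf_iterate_le`, with `n = k + m * k` and `j = m * k`. -/
theorem meetMap_iterate_mul_le (hAD : Function.Commute A D) (hA : o ≤ A o) (hD : o ≤ D o) {k : ℕ}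
    (hk : 1 ≤ k) (hrig : A (meetMap A D o) ⊓ D^[k] o ≤ A o) (m : ℕ) :
    (meetMap A D)^[m * k] o ≤ A^[m] o := by
  induction m with
  | zero => simp
  | succ m ih =>
    rw [Function.iterate_succ_apply' A]
    refine le_trans ?_ (A.monotone ih)
    refine le_trans (le_inf ?_ ?_)
      (map_meetMap_iterate_inf_iterate_le hAD hD hk hrig (Nat.le_add_left (m * k) k))
    · rw [Nat.succ_mul, Nat.add_comm]
      refine (meetMap_iterate_le_succ hA hD _).trans ?_
      rw [Function.iterate_succ_apply']
      exact inf_le_left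
    · simpa using meetMap_iterate_le (i := 0) (j := (m + 1) * k) (n := (m + 1) * k)
        (by omega) o |>.trans_eq (by simp [Nat.succ_mul, Nat.add_comm])

theorem iterate_inf_iterate_le (hAD : Function.Commute A D) (hAg : Function.Commute A g)
    (hDg : Function.Commute D g) {N : ℕ} (hN : 0 < N) (hg : (meetMap A D)^[N] o = g o)
    (hA : o ≤ A o) (hD : o ≤ D o) {k : ℕ} (hk : 1 ≤ k)
    (hrig : A (meetMap A D o) ⊓ D^[k] o ≤ A o) (a b : ℕ) :
    A^[a] o ⊓ D^[b] o ≤ (meetMap A D)^[b] o := by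
  refine le_trans (le_inf ?_ inf_le_right)
    (meetMap_iterate_inf_iterate_le hAD hD hk hrig (le_max_right a b))
  rw [← iterate_inf_eq_meetMap_iterate hAD hAg hDg hN hg]
  exact inf_le_inf (le_iterate_of_le hA (le_max_left a b)) (le_iterate_of_le hD (le_max_right a b))

end CommutingAutomorphisms

/-! ### Multiplication by powers of `Δ` and greedy lists -/

variable {G : Type*} [Group G] [Lattice G] [MulLeftMono G] {Δ : G}

theorem IsGreedy.one_le_tail {x : G} {xs : List G} (h : IsGreedy Δ (x :: xs)) :
    1 ≤ xs.prod := by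
  have : x ≤ x * xs.prod := by
    rw [← List.prod_cons]; exact h.2.1.le.trans inf_le_left
  simpa using this

theorem IsGarsideElement.mul_le_mul_iff (hΔ : IsGarsideElement Δ) {a b : G} :
    a * Δ ≤ b * Δ ↔ a ≤ b := by
  refine ⟨fun h => ?_, hΔ.mul_right_mono⟩
  have h1 : (1 : G) ≤ (a * Δ)⁻¹ * (b * Δ) := by simpa using mul_le_mul_right h (a * Δ)⁻¹
  rw [← Set.mem_Ici, ← hΔ.conj_positive] at h1
  obtain ⟨x, hx, hxe⟩ := h1
  have : x = a⁻¹ * b := by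
    have := congrArg (fun z => Δ * z * Δ⁻¹) hxe
    simpa [mul_assoc] using this
  have hx' : 1 ≤ a⁻¹ * b := this ▸ hx
  simpa using mul_le_mul_right hx' a

theorem IsGarsideElement.mul_zpow_le_iff (hΔ : IsGarsideElement Δ) {a b : G} (q : ℤ) :
    a * Δ ^ q ≤ b * Δ ^ q ↔ a ≤ b := by
  induction q using Int.induction_on generalizing a b with
  | zero => simp
  | succ n ih => rw [zpow_add_one, ← mul_assoc, ← mul_assoc, hΔ.mul_le_mul_iff, ih]
  | pred n ih =>
    rw [← hΔ.mul_le_mul_iff, mul_assoc, mul_assoc, ← zpow_add_one, sub_add_cancel, ih]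

/-- The order automorphism `w ↦ X w Δ ^ q`. -/
def IsGarsideElement.mulZpow (hΔ : IsGarsideElement Δ) (X : G) (q : ℤ) : G ≃o G where
  toFun w := X * w * Δ ^ q
  invFun w := X⁻¹ * w * Δ ^ (-q)
  left_inv w := by simp [mul_assoc]
  right_inv w := by simp [mul_assoc]
  map_rel_iff' {a b} := by
    simp only [Equiv.coe_fn_mk, hΔ.mul_zpow_le_iff]
    exact mul_le_mul_iff_left X

theorem IsGarsideElement.mulZpow_apply (hΔ : IsGarsideElement Δ) (X : G) (q : ℤ) (w : G) :
    hΔ.mulZpow X q w = X * w * Δ ^ q := rfl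

theorem IsGarsideElement.mulZpow_iterate (hΔ : IsGarsideElement Δ) (X : G) (q : ℤ) (n : ℕ)
    (w : G) : (hΔ.mulZpow X q)^[n] w = X ^ n * w * Δ ^ (n * q) := by
  induction n with
  | zero => simp
  | succ n ih =>
    rw [Function.iterate_succ_apply', ih, mulZpow_apply, pow_succ']
    push_cast
    rw [add_mul, zpow_add, one_mul]
    simp only [mul_assoc]

theorem IsGarsideElement.mulZpow_commute (hΔ : IsGarsideElement Δ) {X Y : G} (h : X * Y = Y * X)
    (q s : ℤ) : Function.Commute (hΔ.mulZpow X q) (hΔ.mulZpow Y s) := fun w => by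
  calc X * (Y * w * Δ ^ s) * Δ ^ q = X * Y * w * (Δ ^ s * Δ ^ q) := by simp only [mul_assoc]
    _ = Y * X * w * (Δ ^ q * Δ ^ s) := by rw [h, zpow_mul_comm Δ s q]
    _ = Y * (X * w * Δ ^ q) * Δ ^ s := by simp only [mul_assoc]

theorem IsGarsideElement.inf_mul_zpow (hΔ : IsGarsideElement Δ) (a b : G) (q : ℤ) :
    (a ⊓ b) * Δ ^ q = a * Δ ^ q ⊓ b * Δ ^ q := by
  have := (hΔ.mulZpow 1 q).map_inf a b
  simpa only [mulZpow_apply, one_mul] using this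

theorem IsGarsideElement.zpow_le_zpow (hΔ : IsGarsideElement Δ) {q s : ℤ} (h : q ≤ s) :
    Δ ^ q ≤ Δ ^ s := by
  obtain ⟨n, rfl⟩ := Int.le.dest h
  rw [zpow_add, zpow_natCast]
  exact le_mul_of_one_le_right' (one_le_pow_of_one_le' hΔ.one_le n)

/-- Positivity is a separate hypothesis because `IsGreedy` does not force the last factor to be
positive; for a tail it follows from the greedy condition at the head. -/
theorem IsGreedy.prod_take (hΔ : IsGarsideElement Δ) {xs : List G} (h : IsGreedy Δ xs)
    (h1 : 1 ≤ xs.prod) (k : ℕ) : (xs.take k).prod = xs.prod ⊓ Δ ^ k := by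
  induction xs generalizing k with
  | nil => simpa using (inf_eq_left.2 (one_le_pow_of_one_le' hΔ.one_le k)).symm
  | cons x xs ih =>
    rcases k with _ | k
    · simpa using h1
    · rw [List.take_succ_cons, List.prod_cons, ih h.2.2 h.one_le_tail, mul_inf,
        ← List.prod_cons]
      have e : x * Δ ^ k = (x :: xs).prod * Δ ^ k ⊓ Δ ^ (k + 1) := by
        conv_lhs => rw [h.2.1]
        rw [← zpow_natCast, hΔ.inf_mul_zpow, ← zpow_one_add, add_comm, ← Nat.cast_succ,
          zpow_natCast, zpow_natCast]
      rw [e, ← inf_assoc, (inf_eq_left (a := (x :: xs).prod)).2]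
      exact le_mul_of_one_le_right' (one_le_pow_of_one_le' hΔ.one_le k)

theorem IsGreedy.take {xs : List G} (hΔ : IsGarsideElement Δ) (h : IsGreedy Δ xs)
    (h1 : 1 ≤ xs.prod) (k : ℕ) : IsGreedy Δ (xs.take k) := by
  induction xs generalizing k with
  | nil => simpa using h
  | cons x xs ih =>
    rcases k with _ | k
    · trivial
    · refine ⟨h.1, le_antisymm (le_inf ?_ (h.2.1.le.trans inf_le_right)) ?_,
        ih h.2.2 h.one_le_tail k⟩
      · rw [List.prod_cons, h.2.2.prod_take hΔ h.one_le_tail]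
        exact le_mul_of_one_le_right' (le_inf h.one_le_tail
          (one_le_pow_of_one_le' hΔ.one_le k))
      · conv_rhs => rw [h.2.1]
        refine inf_le_inf ?_ le_rfl
        rw [← List.take_succ_cons, h.prod_take hΔ h1]
        exact inf_le_left

theorem IsGreedy.take_eq_take_iff (hΔ : IsGarsideElement Δ) {xs ys : List G}
    (hx : IsGreedy Δ xs) (hy : IsGreedy Δ ys) (hx1 : 1 ≤ xs.prod) (hy1 : 1 ≤ ys.prod) (k : ℕ) :
    xs.take k = ys.take k ↔ xs.prod ⊓ Δ ^ k = ys.prod ⊓ Δ ^ k := by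
  rw [← hx.prod_take hΔ hx1, ← hy.prod_take hΔ hy1]
  exact ⟨fun h => by rw [h],
    fun h => (hx.take hΔ hx1 k).unique (hy.take hΔ hy1 k) hΔ.one_le h⟩

theorem IsGreedy.length_le_iff (hΔ : IsGarsideElement Δ) {xs : List G} (h : IsGreedy Δ xs)
    (h1 : 1 ≤ xs.prod) (n : ℕ) : xs.length ≤ n ↔ xs.prod ≤ Δ ^ n := by
  rw [← inf_eq_left (a := xs.prod), ← h.prod_take hΔ h1]
  refine ⟨fun hn => by rw [List.take_of_length_le hn], fun hn => ?_⟩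
  have e := (h.take hΔ h1 n).unique h hΔ.one_le hn
  have := congrArg List.length e
  rw [List.length_take] at this
  omega

theorem IsGreedy.replicate_append (hΔ : IsGarsideElement Δ) (hne : Δ ≠ 1) {xs : List G}
    (h : IsGreedy Δ xs) (h1 : 1 ≤ xs.prod) (n : ℕ) : IsGreedy Δ (List.replicate n Δ ++ xs) := by
  induction n with
  | zero => simpa using h
  | succ n ih =>
    rw [List.replicate_succ, List.cons_append]
    refine ⟨hne, (inf_eq_right.2 ?_).symm, ih⟩
    rw [List.prod_cons, List.prod_append, List.prod_replicate]
    exact le_mul_of_one_le_right' (one_le_mul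
      (one_le_pow_of_one_le' hΔ.one_le n) h1)

/-! ### Normal form invariants as order conditions -/

theorem leftNormalForm_spec (hΔ : IsGarsideElement Δ) (hne : Δ ≠ 1) (X : G) :
    IsLeftNormalForm Δ X (infimum Δ X) (factors Δ X) := by
  have h : ∃ nf : ℤ × List G, IsLeftNormalForm Δ X nf.1 nf.2 := by
    obtain ⟨p, xs, h⟩ := hΔ.exists_leftNormalForm hne X
    exact ⟨(p, xs), h⟩
  have := h.choose_spec
  rw [infimum, factors, leftNormalForm, dif_pos h]
  exact this

theorem prod_factors (hΔ : IsGarsideElement Δ) (hne : Δ ≠ 1) (X : G) :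
    (factors Δ X).prod = Δ ^ (-infimum Δ X) * X := by
  rw [zpow_neg, eq_inv_mul_iff_mul_eq]
  exact (leftNormalForm_spec hΔ hne X).eq_prod.symm

theorem zpow_infimum_le (hΔ : IsGarsideElement Δ) (hne : Δ ≠ 1) (X : G) :
    Δ ^ infimum Δ X ≤ X := (leftNormalForm_spec hΔ hne X).isGreatest.1

theorem one_le_prod_factors (hΔ : IsGarsideElement Δ) (hne : Δ ≠ 1) (X : G) :
    1 ≤ (factors Δ X).prod := by
  rw [prod_factors hΔ hne]
  simpa using mul_le_mul_right (zpow_infimum_le hΔ hne X) (Δ ^ (-infimum Δ X))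

theorem le_infimum_iff (hΔ : IsGarsideElement Δ) (hne : Δ ≠ 1) {X : G} {q : ℤ} :
    q ≤ infimum Δ X ↔ Δ ^ q ≤ X :=
  ⟨fun h => (hΔ.zpow_le_zpow h).trans (zpow_infimum_le hΔ hne X),
    fun h => (leftNormalForm_spec hΔ hne X).isGreatest.2 h⟩

theorem canonicalLength_le_iff (hΔ : IsGarsideElement Δ) (hne : Δ ≠ 1) {X : G} {n : ℕ} :
    canonicalLength Δ X ≤ n ↔ X ≤ Δ ^ (infimum Δ X + n) := by
  rw [canonicalLength, (leftNormalForm_spec hΔ hne X).greedy.length_le_iff hΔ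
    (one_le_prod_factors hΔ hne X), prod_factors hΔ hne, ← mul_le_mul_iff_left (Δ ^ infimum Δ X),
    zpow_add, zpow_natCast]
  simp

theorem initialFactor_eq (hΔ : IsGarsideElement Δ) (hne : Δ ≠ 1) (X : G) :
    initialFactor Δ X = X * Δ ^ (-infimum Δ X) ⊓ Δ := by
  have hs : ∀ (q : ℤ) (x : G), (shift Δ ^ q) x = Δ ^ (-q) * x * Δ ^ q := by
    intro q x
    rw [shift, ← map_zpow, MulAut.conj_apply]
    simp
  have hx : (factors Δ X).headD 1 = (factors Δ X).prod ⊓ Δ := by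
    have h := (leftNormalForm_spec hΔ hne X).greedy
    generalize factors Δ X = l at h
    rcases l with _ | ⟨x, xs⟩
    · simpa using hΔ.one_le
    · exact h.2.1
  rw [initialFactor, hs, hx, prod_factors hΔ hne, mul_inf, hΔ.inf_mul_zpow, neg_neg]
  congr 1
  · simp
  · rw [← zpow_add_one, ← zpow_add]
    simp

theorem one_le_initialFactor (hΔ : IsGarsideElement Δ) (hne : Δ ≠ 1) (X : G) :
    1 ≤ initialFactor Δ X := by
  rw [initialFactor_eq hΔ hne]
  refine le_inf ?_ hΔ.one_le
  rw [← hΔ.mul_zpow_le_iff (infimum Δ X)]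
  simpa using zpow_infimum_le hΔ hne X

theorem allFactors_take_eq_iff (hΔ : IsGarsideElement Δ) (hne : Δ ≠ 1) (X : G) (k : ℕ) :
    (allFactors Δ ((factors Δ X).prod * initialFactor Δ X)).take k = (factors Δ X).take k ↔
      X * initialFactor Δ X ⊓ Δ ^ (infimum Δ X + k) ≤ X := by
  set Z := (factors Δ X).prod * initialFactor Δ X with hZ
  have hZ1 : 1 ≤ Z := one_le_mul (one_le_prod_factors hΔ hne X)
    (one_le_initialFactor hΔ hne X)
  have hprod : (allFactors Δ Z).prod = Z := by
    have h0 : 0 ≤ infimum Δ Z := (le_infimum_iff hΔ hne).2 (by simpa using hZ1)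
    rw [allFactors, List.prod_append, List.prod_replicate, ← zpow_natCast, Int.toNat_of_nonneg h0]
    exact (leftNormalForm_spec hΔ hne Z).eq_prod.symm
  have hgr : IsGreedy Δ (allFactors Δ Z) :=
    (leftNormalForm_spec hΔ hne Z).greedy.replicate_append hΔ hne (one_le_prod_factors hΔ hne Z) _
  rw [hgr.take_eq_take_iff hΔ (leftNormalForm_spec hΔ hne X).greedy (hprod.symm ▸ hZ1)
    (one_le_prod_factors hΔ hne X), hprod]
  have hle : (factors Δ X).prod ≤ Z :=
    le_mul_of_one_le_right' (one_le_initialFactor hΔ hne X)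
  have h1 : Z ⊓ Δ ^ k = (factors Δ X).prod ⊓ Δ ^ k ↔ Z ⊓ Δ ^ k ≤ (factors Δ X).prod :=
    ⟨fun h => h.le.trans inf_le_left,
      fun h => le_antisymm (le_inf h inf_le_right) (inf_le_inf hle le_rfl)⟩
  rw [h1, hZ, prod_factors hΔ hne, ← mul_le_mul_iff_left (Δ ^ infimum Δ X), mul_inf,
    zpow_add, zpow_natCast]
  simp [mul_assoc]

/-! ### Rigidity in terms of the automorphisms -/

/-- The order automorphism `w ↦ X w Δ ^ (-p)` with `p = inf(X)`. -/
noncomputable def IsGarsideElement.normalizedMul (hΔ : IsGarsideElement Δ) (X : G) : G ≃o G :=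
  hΔ.mulZpow X (-infimum Δ X)

/-- Right multiplication by `Δ` as an order automorphism. -/
def IsGarsideElement.mulDelta (hΔ : IsGarsideElement Δ) : G ≃o G := hΔ.mulZpow 1 1

theorem IsGarsideElement.mulDelta_iterate (hΔ : IsGarsideElement Δ) (n : ℕ) (w : G) :
    hΔ.mulDelta^[n] w = w * Δ ^ n := by
  simp [mulDelta, mulZpow_iterate]

theorem IsGarsideElement.normalizedMul_commute (hΔ : IsGarsideElement Δ) (X : G) :
    Function.Commute (hΔ.normalizedMul X) hΔ.mulDelta :=
  hΔ.mulZpow_commute (by simp) _ _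

theorem IsGarsideElement.one_le_normalizedMul (hΔ : IsGarsideElement Δ) (hne : Δ ≠ 1) (X : G) :
    1 ≤ hΔ.normalizedMul X 1 := by
  rw [normalizedMul, mulZpow_apply, ← hΔ.mul_zpow_le_iff (infimum Δ X)]
  simpa using zpow_infimum_le hΔ hne X

theorem IsGarsideElement.one_le_mulDelta (hΔ : IsGarsideElement Δ) : 1 ≤ hΔ.mulDelta 1 := by
  simpa [mulDelta, mulZpow_apply] using hΔ.one_le

/-- The conjugating map `w ↦ X w Δ ^ (-p) ⊓ w Δ`: if `inf (w⁻¹ X w) = p`, it sends `w` to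
`w * ι(w⁻¹ X w)`. -/
noncomputable def IsGarsideElement.cyclingMap (hΔ : IsGarsideElement Δ) (X : G) : G → G :=
  meetMap (hΔ.normalizedMul X) hΔ.mulDelta

theorem IsGarsideElement.cyclingMap_apply (hΔ : IsGarsideElement Δ) (X w : G) :
    hΔ.cyclingMap X w = X * w * Δ ^ (-infimum Δ X) ⊓ w * Δ := by
  simp [cyclingMap, meetMap, normalizedMul, mulDelta, mulZpow_apply]

theorem IsGarsideElement.cyclingMap_one (hΔ : IsGarsideElement Δ) (hne : Δ ≠ 1) (X : G) :
    hΔ.cyclingMap X 1 = initialFactor Δ X := by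
  rw [cyclingMap_apply, initialFactor_eq hΔ hne, mul_one, one_mul]

/-- The first `k` factors of `X = Δ ^ p x₁ ⋯ x_r` are not changed by multiplying with `ι(X)` on the
right. -/
def IsGarsideElement.IsRigidUpTo (hΔ : IsGarsideElement Δ) (X : G) (k : ℕ) : Prop :=
  hΔ.normalizedMul X (hΔ.cyclingMap X 1) ⊓ hΔ.mulDelta^[k] 1 ≤ hΔ.normalizedMul X 1

theorem IsGarsideElement.isRigidUpTo_iff (hΔ : IsGarsideElement Δ) (hne : Δ ≠ 1) (X : G) (k : ℕ) :
    hΔ.IsRigidUpTo X k ↔ X * initialFactor Δ X ⊓ Δ ^ (infimum Δ X + k) ≤ X := by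
  rw [IsRigidUpTo, hΔ.cyclingMap_one hne, mulDelta_iterate, normalizedMul, mulZpow_apply,
    mulZpow_apply, ← hΔ.mul_zpow_le_iff (infimum Δ X), hΔ.inf_mul_zpow, add_comm, zpow_add,
    zpow_natCast]
  simp [mul_assoc]

theorem IsGarsideElement.isRigidUpTo_anti {hΔ : IsGarsideElement Δ} {X : G} {k l : ℕ}
    (h : hΔ.IsRigidUpTo X l) (hkl : k ≤ l) : hΔ.IsRigidUpTo X k :=
  (inf_le_inf le_rfl (le_iterate_of_le hΔ.one_le_mulDelta hkl)).trans h

omit [MulLeftMono G] in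
open Classical in
theorem rigidityCount_le (Δ X : G) : rigidityCount Δ X ≤ canonicalLength Δ X :=
  Nat.findGreatest_le _

open Classical in
theorem isRigidUpTo_rigidityCount (hΔ : IsGarsideElement Δ) (hne : Δ ≠ 1) (X : G) :
    hΔ.IsRigidUpTo X (rigidityCount Δ X) := by
  rw [hΔ.isRigidUpTo_iff hne, ← allFactors_take_eq_iff hΔ hne]
  exact Nat.findGreatest_spec (P := fun k =>
    (allFactors Δ ((factors Δ X).prod * initialFactor Δ X)).take k = (factors Δ X).take k)
    (Nat.zero_le _) rfl

open Classical in
theorem IsGarsideElement.IsRigidUpTo.le_rigidityCount {hΔ : IsGarsideElement Δ} (hne : Δ ≠ 1)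
    {X : G} {k : ℕ} (h : hΔ.IsRigidUpTo X k) (hk : k ≤ canonicalLength Δ X) :
    k ≤ rigidityCount Δ X :=
  Nat.le_findGreatest hk
    ((allFactors_take_eq_iff hΔ hne X k).2 ((hΔ.isRigidUpTo_iff hne X k).1 h))

/-! ### Cycling in the super summit set -/

/-- `X` has minimal canonical length in its conjugacy class. -/
def HasMinimalLength (Δ X : G) : Prop :=
  ∀ Z, IsConj X Z → canonicalLength Δ X ≤ canonicalLength Δ Z

theorem le_zpow_infimum_add (hΔ : IsGarsideElement Δ) (hne : Δ ≠ 1) (X : G) :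
    X ≤ Δ ^ (infimum Δ X + canonicalLength Δ X) :=
  (canonicalLength_le_iff hΔ hne).1 le_rfl

/-- An infimum above `p` would leave length at most `r - 1`; `1 ≤ r` excludes the truncated case. -/
theorem infimum_eq_of_le (hΔ : IsGarsideElement Δ) (hne : Δ ≠ 1) {Y : G} {p : ℤ} {r : ℕ}
    (hr : 1 ≤ r) (h1 : Δ ^ p ≤ Y) (h2 : Y ≤ Δ ^ (p + r)) (h : r ≤ canonicalLength Δ Y) :
    infimum Δ Y = p ∧ canonicalLength Δ Y = r := by
  have hp : p ≤ infimum Δ Y := (le_infimum_iff hΔ hne).2 h1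
  have hl : canonicalLength Δ Y ≤ (p + r - infimum Δ Y).toNat :=
    (canonicalLength_le_iff hΔ hne).2 (h2.trans (hΔ.zpow_le_zpow (by omega)))
  omega

omit [MulLeftMono G] in
theorem isConj_cycling (Δ X : G) : IsConj X (cycling Δ X) :=
  isConj_iff.2 ⟨(initialFactor Δ X)⁻¹, by simp [cycling]⟩

theorem infimum_cycling (hΔ : IsGarsideElement Δ) (hne : Δ ≠ 1) {X : G}
    (hX : 1 ≤ canonicalLength Δ X) (hmin : HasMinimalLength Δ X) :
    infimum Δ (cycling Δ X) = infimum Δ X ∧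
      canonicalLength Δ (cycling Δ X) = canonicalLength Δ X := by
  set p := infimum Δ X with hp
  set r := canonicalLength Δ X with hr
  set i := initialFactor Δ X with hi
  have hi1 : 1 ≤ i := one_le_initialFactor hΔ hne X
  have hie : i = X * Δ ^ (-p) ⊓ Δ := initialFactor_eq hΔ hne X
  have hmul : i * cycling Δ X = X * i := by simp [cycling, ← hi, mul_assoc]
  have hiX : i * Δ ^ p ≤ X := by
    have := (hΔ.mul_zpow_le_iff p).2 (hie.le.trans inf_le_left)
    simpa [mul_assoc] using this
  have hiΔ : X * i ≤ X * Δ := mul_le_mul_right (hie.le.trans inf_le_right) X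
  refine infimum_eq_of_le hΔ hne hX ?_ ?_ (hmin _ (isConj_cycling Δ X))
  · rw [← mul_le_mul_iff_left i, hmul]
    exact hiX.trans (le_mul_of_one_le_right' hi1)
  · rw [← mul_le_mul_iff_left i, hmul]
    conv_rhs => rw [hie]
    rw [hΔ.inf_mul_zpow]
    refine le_inf (hiΔ.trans ?_) (hiΔ.trans ?_)
    · rw [mul_assoc, ← zpow_add, neg_add_cancel_left]
      refine mul_le_mul_right ?_ X
      simpa using hΔ.zpow_le_zpow (q := 1) (s := r) (by exact_mod_cast hX)
    · rw [← zpow_one_add, add_comm, zpow_add_one]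
      exact hΔ.mul_right_mono (le_zpow_infimum_add hΔ hne X)

theorem HasMinimalLength.cycling (hΔ : IsGarsideElement Δ) (hne : Δ ≠ 1) {X : G}
    (hX : 1 ≤ canonicalLength Δ X) (hmin : HasMinimalLength Δ X) :
    HasMinimalLength Δ (cycling Δ X) := fun Z hZ => by
  rw [(infimum_cycling hΔ hne hX hmin).2]
  exact hmin Z ((isConj_cycling Δ X).trans hZ)

theorem iterate_cycling (hΔ : IsGarsideElement Δ) (hne : Δ ≠ 1) {X : G}
    (hX : 1 ≤ canonicalLength Δ X) (hmin : HasMinimalLength Δ X) (t : ℕ) :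
    HasMinimalLength Δ ((cycling Δ)^[t] X) ∧
      infimum Δ ((cycling Δ)^[t] X) = infimum Δ X ∧
      canonicalLength Δ ((cycling Δ)^[t] X) = canonicalLength Δ X := by
  induction t with
  | zero => exact ⟨hmin, rfl, rfl⟩
  | succ t ih =>
    obtain ⟨h1, h2, h3⟩ := ih
    rw [Function.iterate_succ_apply']
    have h := infimum_cycling hΔ hne (h3 ▸ hX) h1
    exact ⟨h1.cycling hΔ hne (h3 ▸ hX), h.1.trans h2, h.2.trans h3⟩

/-- `w⁻¹ X w = Y` and `inf X = inf Y` imply that left multiplication by `w` intertwines the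
cycling maps of `Y` and `X`. -/
theorem cyclingMap_mul (hΔ : IsGarsideElement Δ) {X Y w : G} (hw : X * w = w * Y)
    (hp : infimum Δ Y = infimum Δ X) (z : G) :
    hΔ.cyclingMap X (w * z) = w * hΔ.cyclingMap Y z := by
  rw [hΔ.cyclingMap_apply, hΔ.cyclingMap_apply, mul_inf, ← mul_assoc X, hw, hp]
  simp only [mul_assoc]

theorem mul_cyclingMap_iterate (hΔ : IsGarsideElement Δ) (hne : Δ ≠ 1) {X : G}
    (hX : 1 ≤ canonicalLength Δ X) (hmin : HasMinimalLength Δ X) (t : ℕ) :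
    X * (hΔ.cyclingMap X)^[t] 1 = (hΔ.cyclingMap X)^[t] 1 * (cycling Δ)^[t] X := by
  induction t with
  | zero => simp
  | succ t ih =>
    have h := cyclingMap_mul hΔ ih (iterate_cycling hΔ hne hX hmin t).2.1 1
    rw [mul_one, hΔ.cyclingMap_one hne] at h
    rw [Function.iterate_succ_apply', Function.iterate_succ_apply', h, ← mul_assoc, ih, cycling]
    simp [mul_assoc]

theorem isRigidUpTo_cycling (hΔ : IsGarsideElement Δ) (hne : Δ ≠ 1) {X : G}
    (hX : 1 ≤ canonicalLength Δ X) (hmin : HasMinimalLength Δ X) {k : ℕ}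
    (h : hΔ.IsRigidUpTo X k) : hΔ.IsRigidUpTo (cycling Δ X) k := by
  set i := initialFactor Δ X with hi
  have hmul : X * i = i * cycling Δ X := by simp [cycling, ← hi, mul_assoc]
  have hinf := (infimum_cycling hΔ hne hX hmin).1
  have hAD := hΔ.normalizedMul_commute X
  have hA : Function.Commute (hΔ.cyclingMap X) (hΔ.normalizedMul X) :=
    meetMap_commute (Function.Commute.refl _) hAD.symm
  have hD : Function.Commute (hΔ.cyclingMap X) hΔ.mulDelta :=
    meetMap_commute hAD (Function.Commute.refl _)
  have hAY : ∀ z, hΔ.normalizedMul X (i * z) = i * hΔ.normalizedMul (cycling Δ X) z := by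
    intro z
    simp only [IsGarsideElement.normalizedMul, IsGarsideElement.mulZpow_apply, hinf]
    rw [← mul_assoc X, hmul]
    simp only [mul_assoc]
  -- Moving the base point of the rigidity inequality from `1` to `ι(X)`; left cancellation of
  -- `ι(X)` then yields the inequality for the cycling.
  have h' := meetMap_mono (hΔ.normalizedMul X) hΔ.mulDelta h
  rw [meetMap_inf] at h'
  change hΔ.cyclingMap X _ ⊓ hΔ.cyclingMap X _ ≤ hΔ.cyclingMap X _ at h'
  rw [hA, hA, (hD.iterate_right k) 1, hΔ.cyclingMap_one hne, ← hi, hΔ.mulDelta_iterate] at h'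
  rw [IsGarsideElement.IsRigidUpTo, ← mul_le_mul_iff_left i, mul_inf, ← hAY, ← hAY,
    ← cyclingMap_mul hΔ hmul hinf, hΔ.mulDelta_iterate]
  simpa using h'

theorem rigidity_le_cycling (hΔ : IsGarsideElement Δ) (hne : Δ ≠ 1) {X : G}
    (hX : 1 ≤ canonicalLength Δ X) (hmin : HasMinimalLength Δ X) :
    rigidity Δ X ≤ rigidity Δ (cycling Δ X) := by
  have hl := (infimum_cycling hΔ hne hX hmin).2
  have hc : rigidityCount Δ X ≤ rigidityCount Δ (cycling Δ X) :=
    (isRigidUpTo_cycling hΔ hne hX hmin (isRigidUpTo_rigidityCount hΔ hne X)).le_rigidityCount hne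
      (hl.symm ▸ rigidityCount_le Δ X)
  rw [rigidity, rigidity, hl, if_neg (by omega), if_neg (by omega)]
  gcongr

theorem monotone_rigidity_iterate_cycling (hΔ : IsGarsideElement Δ) (hne : Δ ≠ 1) {X : G}
    (hX : 1 ≤ canonicalLength Δ X) (hmin : HasMinimalLength Δ X) :
    Monotone fun t => rigidity Δ ((cycling Δ)^[t] X) := by
  refine monotone_nat_of_le_succ fun t => ?_
  obtain ⟨h1, -, h3⟩ := iterate_cycling hΔ hne hX hmin t
  rw [Function.iterate_succ_apply']
  exact rigidity_le_cycling hΔ hne (h3 ▸ hX) h1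

/-! ### Rigidity of powers -/

theorem initialFactor_ne_one (hΔ : IsGarsideElement Δ) (hne : Δ ≠ 1) {X : G}
    (hX : 1 ≤ canonicalLength Δ X) : initialFactor Δ X ≠ 1 := by
  intro h
  rw [initialFactor_eq hΔ hne] at h
  refine hΔ.inf_ne_one (fun h1 => ?_) h
  have : canonicalLength Δ X ≤ 0 := (canonicalLength_le_iff hΔ hne).2 (by
    rw [mul_eq_one_iff_eq_inv, zpow_neg, inv_inv] at h1
    simpa using h1.le)
  omega

theorem initialFactor_ne_delta (hΔ : IsGarsideElement Δ) (hne : Δ ≠ 1) (X : G) :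
    initialFactor Δ X ≠ Δ := by
  intro h
  rw [initialFactor_eq hΔ hne, inf_eq_right, ← hΔ.mul_zpow_le_iff (infimum Δ X), mul_assoc,
    ← zpow_add, neg_add_cancel, zpow_zero, mul_one, ← zpow_one_add,
    ← le_infimum_iff hΔ hne] at h
  omega

theorem rigidity_le_pow (hΔ : IsGarsideElement Δ) (hne : Δ ≠ 1) {X : G}
    (hX : 1 ≤ canonicalLength Δ X) (hmin : HasMinimalLength Δ X) {N : ℕ} (hN : 0 < N)
    (hper : (cycling Δ)^[N] X = X) {m : ℕ} (hm : 1 ≤ m) :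
    rigidity Δ X ≤ rigidity Δ (X ^ m) := by
  set k := rigidityCount Δ X with hk
  set r := canonicalLength Δ X with hr
  set p := infimum Δ X with hp
  have hk0 : (0 : ℚ) ≤ rigidity Δ (X ^ m) := by rw [rigidity]; split_ifs <;> positivity
  rcases Nat.eq_zero_or_pos k with h0 | hkpos
  · refine le_trans (le_of_eq ?_) hk0
    rw [rigidity, ← hk, h0]
    simp
  have hkr : k ≤ r := rigidityCount_le Δ X
  have hrig : hΔ.IsRigidUpTo X k := isRigidUpTo_rigidityCount hΔ hne X
  set A := hΔ.normalizedMul X with hA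
  set D := hΔ.mulDelta with hD
  have hAD : Function.Commute A D := hΔ.normalizedMul_commute X
  have hA1 : 1 ≤ A 1 := hΔ.one_le_normalizedMul hne X
  have hD1 : 1 ≤ D 1 := hΔ.one_le_mulDelta
  set g := (hΔ.cyclingMap X)^[N] 1 with hg
  have hcomm : X * g = g * X := by
    have := mul_cyclingMap_iterate hΔ hne hX hmin N
    rwa [hper] at this
  have hle := iterate_inf_iterate_le (g := hΔ.mulZpow g 0) hAD
    (hΔ.mulZpow_commute hcomm _ _) (hΔ.mulZpow_commute (by simp) _ _) hN
    (hg.symm.trans (by simp [hΔ.mulZpow_apply])) hA1 hD1 hkpos hrig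
  have hAm : A^[m] 1 = X ^ m * Δ ^ (-(m * p)) := by
    rw [hA, IsGarsideElement.normalizedMul, hΔ.mulZpow_iterate]
    simp [← hp]
  have hι : A^[m] 1 ⊓ Δ = initialFactor Δ X := by
    have h1 : D^[1] 1 = Δ := by rw [hΔ.mulDelta_iterate]; simp
    rw [← hΔ.cyclingMap_one hne, show A^[m] 1 ⊓ Δ = A^[m] 1 ⊓ D^[1] 1 by rw [h1]]
    refine le_antisymm (hle m 1) (le_inf ?_ inf_le_right)
    exact inf_le_left.trans (le_iterate_of_le (m := 1) hA1 hm)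
  have hinf : infimum Δ (X ^ m) = m * p := by
    refine le_antisymm ?_ ((le_infimum_iff hΔ hne).2 ?_)
    -- A larger infimum would put `Δ` below `A^[m] 1`, making the initial factor of `X` equal to
    -- `Δ`.
    · by_contra! hlt
      have h2 := (le_infimum_iff hΔ hne).1 (Int.add_one_le_of_lt hlt)
      rw [← hΔ.mul_zpow_le_iff (-(m * p)), ← zpow_add, ← hAm] at h2
      refine initialFactor_ne_delta hΔ hne X (hι ▸ inf_eq_right.2 ?_)
      simpa using h2
    · have h2 : 1 ≤ A^[m] 1 := le_iterate_of_le (m := 0) hA1 (Nat.zero_le m)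
      rw [hAm, ← hΔ.mul_zpow_le_iff (m * p)] at h2
      simpa [mul_assoc] using h2
  have hnorm : ∀ w, hΔ.normalizedMul (X ^ m) w = A^[m] w := by
    intro w
    rw [hA, IsGarsideElement.normalizedMul, IsGarsideElement.normalizedMul, hΔ.mulZpow_iterate,
      hΔ.mulZpow_apply, hinf, mul_neg]
  have hιm : hΔ.cyclingMap (X ^ m) 1 = hΔ.cyclingMap X 1 := by
    rw [hΔ.cyclingMap_one hne, hΔ.cyclingMap_one hne, ← hι, initialFactor_eq hΔ hne, hinf, hAm]
  have hrigm : hΔ.IsRigidUpTo (X ^ m) (m * k) := by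
    rw [IsGarsideElement.IsRigidUpTo, hιm, hnorm, hnorm]
    -- Bound `ι(X)` by `A 1`, so that one more power of `A` absorbs it.
    refine le_trans (le_trans (inf_le_inf ?_ le_rfl) (hle (m + 1) (m * k)))
      (meetMap_iterate_mul_le hAD hA1 hD1 hkpos hrig m)
    rw [Function.iterate_succ_apply]
    exact A.monotone.iterate m inf_le_left
  have hlen : canonicalLength Δ (X ^ m) ≤ m * r := by
    have h1 : ∀ n : ℕ, A^[n] 1 ≤ D^[n * r] 1 := by
      intro n
      induction n with
      | zero => simp
      | succ n ih =>
        rw [Function.iterate_succ_apply', Nat.succ_mul, Function.iterate_add_apply]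
        refine (A.monotone ih).trans ?_
        rw [(hAD.iterate_right (n * r)) 1]
        refine D.monotone.iterate (n * r) ?_
        rw [hΔ.mulDelta_iterate, ← hΔ.mul_zpow_le_iff p, one_mul, ← zpow_natCast, ← zpow_add,
          add_comm]
        simpa [hA, IsGarsideElement.normalizedMul, hΔ.mulZpow_apply, ← hp]
          using le_zpow_infimum_add hΔ hne X
    have h2 := h1 m
    rw [hAm, hΔ.mulDelta_iterate, ← hΔ.mul_zpow_le_iff (m * p), one_mul, ← zpow_natCast Δ,
      ← zpow_add, add_comm] at h2
    rw [canonicalLength_le_iff hΔ hne, hinf]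
    simpa [mul_assoc] using h2
  have hpos : canonicalLength Δ (X ^ m) ≠ 0 := by
    intro h
    have h1 := (canonicalLength_le_iff hΔ hne (n := 0)).1 h.le
    rw [hinf, ← hΔ.mul_zpow_le_iff (-(m * p)), ← hAm, Nat.cast_zero, add_zero, ← zpow_add,
      add_neg_cancel, zpow_zero] at h1
    refine initialFactor_ne_one hΔ hne hX (le_antisymm ?_ (one_le_initialFactor hΔ hne X))
    rw [← hι]
    exact inf_le_left.trans h1
  -- The length of `X ^ m` may be less than `m * k`, and the count is capped by it.
  have hcount : min (m * k) (canonicalLength Δ (X ^ m)) ≤ rigidityCount Δ (X ^ m) :=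
    (IsGarsideElement.isRigidUpTo_anti hrigm (min_le_left _ _)).le_rigidityCount hne
      (min_le_right _ _)
  rw [rigidity, rigidity, if_neg (by omega), if_neg hpos, ← hk, ← hr,
    div_le_div_iff₀ (by exact_mod_cast hX) (by exact_mod_cast Nat.pos_of_ne_zero hpos)]
  norm_cast
  refine le_trans ?_ (Nat.mul_le_mul_right r hcount)
  rcases min_choice (m * k) (canonicalLength Δ (X ^ m)) with h | h <;> rw [h]
  · calc k * canonicalLength Δ (X ^ m) ≤ k * (m * r) := Nat.mul_le_mul_left k hlen
      _ = m * k * r := by ring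
  · rw [Nat.mul_comm]
    exact Nat.mul_le_mul_left _ hkr

end Garside

theorem mainTheorem10 {G : Type*} [Group G] [Lattice G] [MulLeftMono G] (Δ : G)
    (hΔ : Garside.IsGarsideElement Δ) (X : G) (hX : 1 ≤ Garside.canonicalLength Δ X) :
    (X ∈ Garside.ultraSummitSet Δ X →
      ∀ m : ℕ, 1 < m → Garside.rigidity Δ X ≤ Garside.rigidity Δ (X ^ m)) ∧
    (X ∈ Garside.superSummitSet Δ X →
      ∀ t : ℕ, 1 ≤ t → Garside.rigidity Δ X ≤ Garside.rigidity Δ ((Garside.cycling Δ)^[t] X)) ∧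
    (X ∈ Garside.ultraSummitSet Δ X →
      ∀ t : ℕ, 1 ≤ t → Garside.rigidity Δ X = Garside.rigidity Δ ((Garside.cycling Δ)^[t] X)) := by
  -- If `Δ = 1` then `G` is trivial and no maximal exponent exists, so the default normal form `(0,
  -- [])` applies and its length `0` contradicts `hX`.
  have hne : Δ ≠ 1 := by
    intro h
    have htriv : ∀ x : G, x = 1 := by
      intro x
      obtain ⟨n, h1, h2⟩ := hΔ.exists_le_pow x
      rw [h, one_pow] at h1 h2
      refine le_antisymm h1 ?_
      simpa using mul_le_mul_right h2 x
    have hnone : ¬ ∃ nf : ℤ × List G, Garside.IsLeftNormalForm Δ X nf.1 nf.2 := by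
      rintro ⟨⟨p, xs⟩, hnf⟩
      have : p + 1 ≤ p := hnf.isGreatest.2 (by
        rw [Set.mem_ofPred_eq, htriv (Δ ^ (p + 1)), htriv X])
      omega
    rw [Garside.canonicalLength, Garside.factors, Garside.leftNormalForm, dif_neg hnone] at hX
    exact absurd hX (by simp)
  refine ⟨?_, ?_, ?_⟩
  · rintro ⟨⟨-, hmin⟩, N, hN, hper⟩ m hm
    exact Garside.rigidity_le_pow hΔ hne hX hmin hN hper hm.le
  · rintro ⟨-, hmin⟩ t -
    exact Garside.monotone_rigidity_iterate_cycling hΔ hne hX hmin (Nat.zero_le t)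
  · rintro ⟨⟨-, hmin⟩, N, hN, hper⟩ t -
    have hmono := Garside.monotone_rigidity_iterate_cycling hΔ hne hX hmin
    refine le_antisymm (hmono (Nat.zero_le t)) ?_
    -- `N * t` is a multiple of the period not below `t`, so cycling has returned to `X` there.
    refine (hmono (Nat.le_mul_of_pos_left t hN)).trans_eq ?_
    have : (Garside.cycling Δ)^[N * t] X = X := by
      rw [Function.iterate_mul]
      exact Function.iterate_fixed hper t
    simp only [this]
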